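/- Let $\mathcal R=\langle G,Q,P,F \mid [G,Q]=[Q,P]=[P,F]=1\rangle$ be the right-angled Artin group whose defining graph is the path $G - Q - P - F$ with four vertices. Let $\mathbb F$ be a field with prime subfield $\mathbb P$ (for example $\mathbb F=\mathbb C$, or $\mathbb F$ an algebraically closed field of characteristic $p>0$ and of infinite transcendence degree over $\mathbb P=\mathbb F_p$). Let $a,b,c,d,\alpha,\beta,\gamma,\delta,\lambda\in\mathbb F$ with $ad-bc\neq 0$, $\alpha\delta-\beta\gamma\neq 0$ and $\lambda\neq 0$, and consider the following matrices in $GL(3,\mathbb F)$: $$G_0=\begin{pmatrix}a&b&0\\c&d&0\\0&0&1\end{pmatrix},\quad Q_0=\begin{pmatrix}\lambda&0&0\\0&\lambda&0\\0&0&\lambda^{-1}\end{pmatrix},\quad P_0=\begin{pmatrix}\lambda&0&0\\0&\lambda^{-1}&0\\0&0&\lambda\end{pmatrix},\quad F_0=\begin{pmatrix}\alpha&0&\beta\\0&1&0\\\gamma&0&\delta\end{pmatrix}.$$ Suppose that (1) for every integer $n\neq 0$, both off-diagonal entries of $\begin{pmatrix}\alpha&\beta\\\gamma&\delta\end{pmatrix}^n$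 are nonzero; (2) the subgroup of $GL(2,\mathbb F)$ generated by $\begin{pmatrix}a&b\\c&d\end{pmatrix}$ and $\begin{pmatrix}\lambda&0\\0&\lambda^{-1}\end{pmatrix}$ is a non-abelian free group, and its only element with top left entry equal to $1$ is the identity $I_2$. Let $\phi\in\mathbb F$ be transcendental over the field $\mathbb P(a,b,c,d,\alpha,\beta,\gamma,\delta,\lambda)$ and let $D=\mathrm{diag}(\phi,\phi^2,\phi^3)$. Then $F_0P_0F_0^{-1}=P_0=DP_0D^{-1}$, and the assignment $$G\mapsto F_0G_0F_0^{-1},\qquad Q\mapsto F_0Q_0F_0^{-1},\qquad P\mapsto DP_0D^{-1}=P_0,\qquad F\mapsto DF_0D^{-1}$$ extends to an injective homomorphism $\mathcal R\to GL(3,\mathbb F)$, that is, to a faithful representation of $\mathcal R$. -/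

import Mathlib

noncomputable section

/-- The right angled Artin group of a simple graph: one generator for each vertex, and the
commutators of the pairs of adjacent vertices as relators. -/
abbrev RAAG {V : Type*} (Γ : SimpleGraph V) : Type _ :=
  PresentedGroup {r : FreeGroup V | ∃ u v : V, Γ.Adj u v ∧
    r = FreeGroup.of u * FreeGroup.of v * (FreeGroup.of u)⁻¹ * (FreeGroup.of v)⁻¹}

/-- The generator of the right angled Artin group that belongs to the vertex `v`. -/
def RAAG.gen {V : Type*} (Γ : SimpleGraph V) (v : V) : RAAG Γ :=
  PresentedGroup.of v

/-- The invertible matrix with rows `(a, b)` and `(c, d)`. -/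
def gl2 {F : Type*} [Field F] (a b c d : F) (h : a * d - b * c ≠ 0) : GL (Fin 2) F :=
  Matrix.GeneralLinearGroup.mkOfDetNeZero !![a, b; c, d] (by
    rw [Matrix.det_fin_two_of]; exact h)

/-- The invertible diagonal matrix with diagonal entries `lam` and `lam⁻¹`. -/
def gl2Diag {F : Type*} [Field F] (lam : F) (h : lam ≠ 0) : GL (Fin 2) F :=
  gl2 lam 0 0 lam⁻¹ (by simp [h])

/-- A group is a non-abelian free group. -/
def IsNonabelianFree (H : Type*) [Group H] : Prop :=
  IsFreeGroup H ∧ ∃ x y : H, x * y ≠ y * x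

def matG₀ {F : Type*} [Field F] (a b c d : F) : Matrix (Fin 3) (Fin 3) F :=
  !![a, b, 0; c, d, 0; 0, 0, 1]

def matQ₀ {F : Type*} [Field F] (lam : F) : Matrix (Fin 3) (Fin 3) F :=
  !![lam, 0, 0; 0, lam, 0; 0, 0, lam⁻¹]

def matP₀ {F : Type*} [Field F] (lam : F) : Matrix (Fin 3) (Fin 3) F :=
  !![lam, 0, 0; 0, lam⁻¹, 0; 0, 0, lam]

def matF₀ {F : Type*} [Field F] (α β γ δ : F) : Matrix (Fin 3) (Fin 3) F :=
  !![α, 0, β; 0, 1, 0; γ, 0, δ]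

def matD {F : Type*} [Field F] (φ : F) : Matrix (Fin 3) (Fin 3) F :=
  !![φ, 0, 0; 0, φ ^ 2, 0; 0, 0, φ ^ 3]

end

-- Write A = ⟨G, Q, P⟩ and C = ⟨P⟩. Since F commutes with P, every element lies in A or has the form
-- a·y with a ∈ A and y = F^n₁ a₁ ⋯ F^nₖ aₖ, all exponents nonzero, all aᵢ ∈ A, and a₁, …, aₖ₋₁
-- outside C. No uniqueness of this form is needed: it suffices that no a·y acts trivially.
--
-- The group A is represented over the field K of the parameters, while conjugation by D puts a
-- factor φ⁻² on one corner entry of F₀^n and φ² on the other. Thus, for ψ = φ or ψ = φ⁻¹, the image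
-- of F^n times ψ² is polynomial in ψ with constant term a nonzero multiple of a matrix unit E_ij.
-- In the image of y the constant terms multiply to a nonzero matrix as soon as the (j, i) entry is
-- nonzero on A ∖ C; then y cannot be represented over K, because ψ is transcendental
-- (`injective_of_leading_term`).
--
-- That entry is a nonzero constant times the difference of two diagonal entries of a block matrix
-- (`conj_cornerBlockGL_apply`). By hypothesis (2) these agree only on C
-- (`eq_of_one_zpow_of_diagonal_eq`), which also gives faithfulness on A.

universe u

/-! ### Free groups: residual finiteness and the Hopf property -/

/-- Free groups are residually finite: the left multiplications by the generators on the finite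
set of suffixes of a word extend to permutations of that set. -/
theorem FreeGroup.exists_hom_finite_ne_one {ι : Type u} (w : FreeGroup ι) (hw : w ≠ 1) :
    ∃ (n : Type u) (_ : Finite n) (f : FreeGroup ι →* Equiv.Perm n), f w ≠ 1 := by
  classical
  obtain ⟨L, rfl⟩ := Quot.exists_rep w
  change FreeGroup.mk L ≠ 1 at hw
  change ∃ (n : Type u) (_ : Finite n) (f : FreeGroup ι →* Equiv.Perm n), f (FreeGroup.mk L) ≠ 1
  let S : Set (FreeGroup ι) := {x | ∃ L', L' <:+ L ∧ x = FreeGroup.mk L'}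
  have hS : S.Finite := by
    refine ((L.tails.toFinset.finite_toSet).image FreeGroup.mk).subset ?_
    rintro x ⟨L', h, rfl⟩
    exact ⟨L', by simpa using h, rfl⟩
  have : Finite S := hS
  have key : ∀ i : ι, ∃ σ : Equiv.Perm S, ∀ s t : S, (t : FreeGroup ι) = FreeGroup.of i * s →
      σ s = t := by
    intro i
    obtain ⟨σ, hσ⟩ := Equiv.Perm.exists_extending_pair
      (α := {p : S × S // (p.2 : FreeGroup ι) = FreeGroup.of i * p.1})
      (fun p => p.1.1) (fun p => p.1.2)
      (by
        rintro ⟨⟨s, t⟩, h⟩ ⟨⟨s', t'⟩, h'⟩ (e : s = s')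
        subst e
        have : t = t' := Subtype.ext (h.trans h'.symm)
        subst this; rfl)
      (by
        rintro ⟨⟨s, t⟩, h⟩ ⟨⟨s', t'⟩, h'⟩ (e : t = t')
        subst e
        have : s = s' := Subtype.ext (mul_left_cancel (h.symm.trans h'))
        subst this; rfl)
    exact ⟨σ, fun s t h => hσ ⟨(s, t), h⟩⟩
  choose σ hσ using key
  refine ⟨S, inferInstance, FreeGroup.lift σ, fun h => hw ?_⟩
  have h1S : (1 : FreeGroup ι) ∈ S := ⟨[], List.nil_suffix, FreeGroup.one_eq_mk⟩
  -- The word read from the right moves the point 1 through its own suffixes and ends at w, so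
  -- acting trivially forces w = 1.
  have main : ∀ L' (hL : L' <:+ L),
      FreeGroup.lift σ (FreeGroup.mk L') ⟨1, h1S⟩ = ⟨FreeGroup.mk L', L', hL, rfl⟩ := by
    intro L'
    induction L' with
    | nil =>
      intro _
      apply Subtype.ext
      change ((FreeGroup.lift σ 1 ⟨1, h1S⟩ : S) : FreeGroup ι) = 1
      rw [_root_.map_one]
      rfl
    | cons x L' ih =>
      intro hL
      have hL' : L' <:+ L := (List.suffix_cons x L').trans hL
      obtain ⟨i, b⟩ := x
      have e : FreeGroup.mk ((i, b) :: L') = FreeGroup.mk [(i, b)] * FreeGroup.mk L' := by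
        rw [FreeGroup.mul_mk]; rfl
      have e2 : FreeGroup.lift σ (FreeGroup.mk ((i, b) :: L')) ⟨1, h1S⟩ =
          FreeGroup.lift σ (FreeGroup.mk [(i, b)]) ⟨FreeGroup.mk L', L', hL', rfl⟩ := by
        rw [e, _root_.map_mul, Equiv.Perm.mul_apply, ih hL']
      rw [e2]
      cases b with
      | true =>
        have : FreeGroup.mk [(i, true)] = FreeGroup.of i := rfl
        rw [this, FreeGroup.lift_apply_of]
        exact hσ i _ _ e
      | false =>
        have : FreeGroup.mk [(i, false)] = (FreeGroup.of i)⁻¹ := rfl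
        rw [this, _root_.map_inv, FreeGroup.lift_apply_of, Equiv.Perm.inv_eq_iff_eq]
        refine (hσ i _ _ ?_).symm
        change FreeGroup.mk L' = FreeGroup.of i * FreeGroup.mk ((i, false) :: L')
        rw [e, this, mul_inv_cancel_left]
  have := main L List.suffix_rfl
  rw [h] at this
  exact (congrArg Subtype.val this).symm

/-- A surjective homomorphism from the free group of rank two to a non-abelian free group is
injective. -/
theorem injective_of_surjective_of_isNonabelianFree {H : Type*} [Group H] (hH : IsNonabelianFree H)
    (f : FreeGroup (Fin 2) →* H) (hf : Function.Surjective f) : Function.Injective f := by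
  classical
  obtain ⟨⟨⟨ι, ⟨B⟩⟩⟩, x, y, hxy⟩ := hH
  -- A free group on at most one generator is cyclic, hence abelian. Two basis elements are all that
  -- is used; the rank of `H` is not determined.
  obtain ⟨i, j, hij⟩ : ∃ i j : ι, i ≠ j := by
    by_contra! hs
    have : Subsingleton ι := ⟨hs⟩
    apply hxy
    apply B.repr.injective
    rw [map_mul, map_mul]
    rcases isEmpty_or_nonempty ι with h0 | ⟨⟨i⟩⟩
    · exact Subsingleton.elim _ _
    · have : ∀ z : FreeGroup ι, z ∈ Subgroup.zpowers (FreeGroup.of i) := by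
        intro z
        induction z using FreeGroup.induction_on with
        | C1 => exact one_mem _
        | of k => rw [hs k i]; exact Subgroup.mem_zpowers _
        | inv_of k h => exact inv_mem h
        | mul a b ha hb => exact mul_mem ha hb
      obtain ⟨m, hm⟩ := this (B.repr x)
      obtain ⟨n, hn⟩ := this (B.repr y)
      rw [← hm, ← hn]
      exact (Commute.zpow_zpow_self _ m n).eq
  rw [injective_iff_map_eq_one]
  intro w hw
  by_contra hne
  obtain ⟨n, _, g, hg⟩ := FreeGroup.exists_hom_finite_ne_one w hne
  let T := Equiv.Perm n
  -- homomorphisms `H → T` with prescribed values on two basis elements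
  let Φ : (Fin 2 → T) → (Fin 2 → T) := fun t k =>
    B.lift (fun l => if l = i then t 0 else if l = j then t 1 else 1) (f (FreeGroup.of k))
  have hΦ : Function.Injective Φ := by
    intro s t hst
    have e : (B.lift (fun l => if l = i then s 0 else if l = j then s 1 else 1)).comp f =
        (B.lift (fun l => if l = i then t 0 else if l = j then t 1 else 1)).comp f :=
      FreeGroup.ext_hom _ _ (fun k => congrFun hst k)
    have e' := B.lift.injective ((MonoidHom.cancel_right hf).1 e)
    have h0 := congrFun e' i
    have h1 := congrFun e' j
    simp only [if_true, if_neg hij.symm] at h0 h1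
    funext k
    fin_cases k
    · exact h0
    · exact h1
  -- An injective self-map of the finite set T² is onto, so `g` factors through `f` and must kill
  -- `w`.
  obtain ⟨t, ht⟩ := (Finite.injective_iff_surjective.1 hΦ) (fun k => g (FreeGroup.of k))
  have : g = (B.lift (fun l => if l = i then t 0 else if l = j then t 1 else 1)).comp f :=
    FreeGroup.ext_hom _ _ (fun k => (congrFun ht k).symm)
  apply hg
  rw [this, MonoidHom.comp_apply, hw, map_one]

/-- Hypothesis (2) says only that the subgroup is free on some basis; this makes the two given
generators a basis. -/
theorem FreeGroup.lift_injective_of_isNonabelianFree {Γ : Type*} [Group Γ] (g h : Γ)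
    (hH : IsNonabelianFree (Subgroup.closure {g, h})) :
    Function.Injective (FreeGroup.lift ![g, h]) := by
  have hr : (FreeGroup.lift ![g, h]).range = Subgroup.closure {g, h} := by
    rw [FreeGroup.range_lift_eq_closure]
    congr 1
    simp [Matrix.range_cons, Set.pair_comm]
  rw [← hr] at hH
  have := injective_of_surjective_of_isNonabelianFree hH _
    (FreeGroup.lift ![g, h]).rangeRestrict_surjective
  exact (MonoidHom.rangeRestrict_injective_iff).1 this

/-! ### Alternating products and their leading terms -/

/-- The products `f ^ n₁ * a₁ * f ^ n₂ * a₂ * ⋯ * f ^ nₖ * aₖ` with `k ≥ 1`, nonzero exponents and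
`aᵢ ∈ A`, where only `aₖ` is allowed to lie in `C`. -/
inductive AlternatingProduct {R : Type*} [Group R] (A C : Subgroup R) (f : R) : R → Prop
  | base (n : ℤ) (a : R) : n ≠ 0 → a ∈ A → AlternatingProduct A C f (f ^ n * a)
  | step (n : ℤ) (a x : R) : n ≠ 0 → a ∈ A → a ∉ C → AlternatingProduct A C f x →
      AlternatingProduct A C f (f ^ n * a * x)

theorem mem_or_eq_mul_alternatingProduct {R : Type*} [Group R] {A C : Subgroup R} {f : R}
    (hC : ∀ c ∈ C, Commute f c) {S : Set R} (hS : S ⊆ A)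
    (htop : Subgroup.closure (insert f S) = ⊤) (x : R) :
    x ∈ A ∨ ∃ a ∈ A, ∃ y, AlternatingProduct A C f y ∧ x = a * y := by
  have hA : ∀ s ∈ A, ∀ y, (y ∈ A ∨ ∃ a ∈ A, ∃ z, AlternatingProduct A C f z ∧ y = a * z) →
      (s * y ∈ A ∨ ∃ a ∈ A, ∃ z, AlternatingProduct A C f z ∧ s * y = a * z) := by
    rintro s hs y (hy | ⟨a, ha, z, hz, rfl⟩)
    · exact Or.inl (mul_mem hs hy)
    · exact Or.inr ⟨s * a, mul_mem hs ha, z, hz, (mul_assoc _ _ _).symm⟩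
  have hf : ∀ (m : ℤ) (y : R),
      (y ∈ A ∨ ∃ a ∈ A, ∃ z, AlternatingProduct A C f z ∧ y = a * z) →
      (f ^ m * y ∈ A ∨ ∃ a ∈ A, ∃ z, AlternatingProduct A C f z ∧ f ^ m * y = a * z) := by
    intro m y hy
    rcases eq_or_ne m 0 with rfl | hm
    · simpa using hy
    rcases hy with hy | ⟨a, ha, z, hz, rfl⟩
    · exact Or.inr ⟨1, one_mem _, _, .base m y hm hy, (one_mul _).symm⟩
    -- An `a` in `C` slides past `f ^ m`, so the two powers of `f` merge; if they cancel, the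
    -- product loses a factor.
    by_cases haC : a ∈ C
    · have hcomm : ∀ t : R, f ^ m * (a * t) = a * (f ^ m * t) := fun t => by
        rw [← mul_assoc, ((hC a haC).zpow_left m).eq, mul_assoc]
      rcases hz with ⟨n, a', hn, ha'⟩ | ⟨n, a', z', hn, ha', haC', hz'⟩
      · rw [hcomm, ← mul_assoc (f ^ m), ← zpow_add]
        rcases eq_or_ne (m + n) 0 with h0 | h0
        · rw [h0, zpow_zero, one_mul]
          exact Or.inl (mul_mem ha ha')
        · exact Or.inr ⟨a, ha, _, .base _ a' h0 ha', rfl⟩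
      · rw [hcomm, mul_assoc (f ^ n), ← mul_assoc (f ^ m), ← zpow_add]
        rcases eq_or_ne (m + n) 0 with h0 | h0
        · rw [h0, zpow_zero, one_mul, ← mul_assoc]
          exact Or.inr ⟨a * a', mul_mem ha ha', z', hz', rfl⟩
        · exact Or.inr ⟨a, ha, _, .step _ a' z' h0 ha' haC' hz', by rw [mul_assoc (f ^ _)]⟩
    · exact Or.inr ⟨1, one_mem _, _, .step m a z hm ha haC hz, by rw [one_mul, mul_assoc]⟩
  have hx : x ∈ Subgroup.closure (insert f S) := htop ▸ Subgroup.mem_top x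
  induction hx using Subgroup.closure_induction_left with
  | one => exact Or.inl (one_mem _)
  | mul_left s hs y _ ih =>
    rcases hs with rfl | hs
    · simpa using hf 1 y ih
    · exact hA s (hS hs) y ih
  | inv_mul_cancel s hs y _ ih =>
    rcases hs with rfl | hs
    · simpa using hf (-1) y ih
    · exact hA _ (inv_mem (hS hs)) y ih

open Polynomial in
-- The constant terms multiply by E_ij g E_ij = g_ji E_ij, so each inner factor contributes a
-- nonzero scalar. The last factor may lie in `C`, where g_ji can vanish; it is therefore kept as an
-- invertible matrix on the right.
theorem exists_leading_term_of_alternatingProduct {R K L n : Type*} [Group R] [Field K] [Field L]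
    [Algebra K L] [Fintype n] [DecidableEq n] (ψ : L) {A C : Subgroup R} {f : R}
    (ρ : R →* GL n L) (i j : n)
    (hA : ∀ a ∈ A, ρ a ∈ (Matrix.GeneralLinearGroup.map (n := n) (algebraMap K L)).range)
    (hAC : ∀ a ∈ A, a ∉ C → (ρ a : Matrix n n L) j i ≠ 0)
    (hf : ∀ m : ℤ, m ≠ 0 → ∃ (B : Matrix n n K[X]) (c : K), c ≠ 0 ∧
      ψ ^ 2 • (ρ (f ^ m) : Matrix n n L) = (aeval ψ).mapMatrix B ∧
      (evalRingHom 0).mapMatrix B = Matrix.single i j c)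
    {x : R} (hx : AlternatingProduct A C f x) :
    ∃ (k : ℕ) (B : Matrix n n K[X]) (c : K) (g : GL n K), k ≠ 0 ∧ c ≠ 0 ∧
      ψ ^ k • (ρ x : Matrix n n L) = (aeval ψ).mapMatrix B ∧
      (evalRingHom 0).mapMatrix B = Matrix.single i j c * (g : Matrix n n K) := by
  have hconst : ∀ g : GL n K, (Matrix.GeneralLinearGroup.map (algebraMap K L) g : Matrix n n L) =
      (aeval ψ).mapMatrix ((Polynomial.C : K →+* K[X]).mapMatrix (g : Matrix n n K)) := by
    intro g
    ext a b
    simp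
  have hconst0 : ∀ g : GL n K,
      (evalRingHom 0).mapMatrix ((Polynomial.C : K →+* K[X]).mapMatrix (g : Matrix n n K)) =
        (g : Matrix n n K) := by
    intro g
    ext a b
    simp
  induction hx with
  | base m a hm ha =>
    obtain ⟨B, c, hc, hB, hB0⟩ := hf m hm
    obtain ⟨g, hg⟩ := hA a ha
    refine ⟨2, B * (Polynomial.C : K →+* K[X]).mapMatrix (g : Matrix n n K), c, g, two_ne_zero, hc,
      ?_, ?_⟩
    · rw [map_mul, map_mul, Matrix.GeneralLinearGroup.coe_mul, ← hg, hconst, ← smul_mul_assoc, hB]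
    · rw [map_mul, hB0, hconst0]
  | step m a y hm ha haC hy ih =>
    obtain ⟨B, c, hc, hB, hB0⟩ := hf m hm
    obtain ⟨g, hg⟩ := hA a ha
    obtain ⟨k, B', c', g', hk, hc', hB', hB0'⟩ := ih
    have hne : (g : Matrix n n K) j i ≠ 0 := by
      intro h0
      apply hAC a ha haC
      rw [← hg, Matrix.GeneralLinearGroup.map_apply, h0, map_zero]
    refine ⟨2 + k, B * (Polynomial.C : K →+* K[X]).mapMatrix (g : Matrix n n K) * B',
      c * (g : Matrix n n K) j i * c', g', by omega, mul_ne_zero (mul_ne_zero hc hne) hc', ?_, ?_⟩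
    · rw [map_mul, map_mul, map_mul, map_mul, Matrix.GeneralLinearGroup.coe_mul,
        Matrix.GeneralLinearGroup.coe_mul, ← hg, hconst, ← hB, ← hB', smul_mul_assoc,
        smul_mul_assoc, mul_smul_comm, smul_smul, pow_add]
    · rw [map_mul, map_mul, hB0, hconst0, hB0', ← mul_assoc,
        Matrix.single_mul_mul_single]

open Polynomial in
theorem injective_of_leading_term {R K L n : Type*} [Group R] [Field K] [Field L]
    [Algebra K L] [Fintype n] [DecidableEq n] {ψ : L} (hψ : Transcendental K ψ)
    {A C : Subgroup R} {f : R}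
    (hR : ∀ x, x ∈ A ∨ ∃ a ∈ A, ∃ y, AlternatingProduct A C f y ∧ x = a * y)
    (ρ : R →* GL n L) (i j : n)
    (hA : ∀ a ∈ A, ρ a ∈ (Matrix.GeneralLinearGroup.map (n := n) (algebraMap K L)).range)
    (hAC : ∀ a ∈ A, a ∉ C → (ρ a : Matrix n n L) j i ≠ 0)
    (hf : ∀ m : ℤ, m ≠ 0 → ∃ (B : Matrix n n K[X]) (c : K), c ≠ 0 ∧
      ψ ^ 2 • (ρ (f ^ m) : Matrix n n L) = (aeval ψ).mapMatrix B ∧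
      (evalRingHom 0).mapMatrix B = Matrix.single i j c)
    (hker : ∀ a ∈ A, ρ a = 1 → a = 1) : Function.Injective ρ := by
  rw [injective_iff_map_eq_one]
  intro x hx
  rcases hR x with hxA | ⟨a, ha, y, hy, rfl⟩
  · exact hker x hxA hx
  exfalso
  obtain ⟨k, B, c, g, hk, hc, hB, hB0⟩ :=
    exists_leading_term_of_alternatingProduct ψ ρ i j hA hAC hf hy
  obtain ⟨u, hu⟩ := hA a⁻¹ (inv_mem ha)
  have hy : ρ y = Matrix.GeneralLinearGroup.map (algebraMap K L) u := by
    rw [hu, map_inv, eq_inv_iff_mul_eq_one, mul_eq_one_comm, ← map_mul, hx]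
  -- Transcendence of `ψ` lifts the equality of values to one of polynomials, and k ≠ 0 then makes
  -- the constant term vanish.
  have hBeq : B = (X ^ k : K[X]) • (Polynomial.C : K →+* K[X]).mapMatrix (u : Matrix n n K) := by
    ext1 p q
    apply (transcendental_iff_injective.1 hψ)
    have := congrFun (congrFun hB p) q
    rw [hy] at this
    simpa only [RingHom.mapMatrix_apply, AlgHom.mapMatrix_apply, Matrix.map_apply,
      Matrix.smul_apply, smul_eq_mul, map_mul, map_pow, aeval_X, aeval_C,
      Matrix.GeneralLinearGroup.map_apply] using this.symm
  have h0 : (evalRingHom 0).mapMatrix B = 0 := by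
    rw [hBeq]
    ext p q
    simp [hk]
  rw [h0] at hB0
  have h1 := congrArg (· * ((g⁻¹ : GL n K) : Matrix n n K)) hB0
  simp only [zero_mul, mul_assoc, ← Matrix.GeneralLinearGroup.coe_mul, mul_inv_cancel,
    Matrix.GeneralLinearGroup.coe_one, mul_one] at h1
  have h2 := congrFun (congrFun h1 i) j
  simp at h2
  exact hc h2.symm

/-! ### Block matrices and conjugation by D -/

section BlockMatrices

variable {K L : Type*} [Field K] [Field L]

/-- A matrix of size two in the rows and columns `0, 1`, and a scalar in the last entry. -/
def upperBlockGL : GL (Fin 2) L × Lˣ →* GL (Fin 3) L :=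
  (Units.map
    ({ toFun := fun p => !![p.1 0 0, p.1 0 1, 0; p.1 1 0, p.1 1 1, 0; 0, 0, p.2]
       map_one' := by ext i j; fin_cases i <;> fin_cases j <;> simp
       map_mul' := fun p q => by
        ext i j
        fin_cases i <;> fin_cases j <;> simp [Matrix.mul_apply, Fin.sum_univ_succ] } :
      Matrix (Fin 2) (Fin 2) L × L →* Matrix (Fin 3) (Fin 3) L)).comp
    MulEquiv.prodUnits.symm.toMonoidHom

theorem coe_upperBlockGL (M : GL (Fin 2) L) (u : Lˣ) :
    (upperBlockGL (M, u) : Matrix (Fin 3) (Fin 3) L) =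
      !![M 0 0, M 0 1, 0; M 1 0, M 1 1, 0; 0, 0, (u : L)] := rfl

/-- A matrix of size two in the rows and columns `0, 2`, and `1` in the middle. -/
def cornerBlockGL : GL (Fin 2) L →* GL (Fin 3) L :=
  Units.map
    ({ toFun := fun M => !![M 0 0, 0, M 0 1; 0, 1, 0; M 1 0, 0, M 1 1]
       map_one' := by ext i j; fin_cases i <;> fin_cases j <;> simp
       map_mul' := fun p q => by
        ext i j
        fin_cases i <;> fin_cases j <;> simp [Matrix.mul_apply, Fin.sum_univ_succ] } :
      Matrix (Fin 2) (Fin 2) L →* Matrix (Fin 3) (Fin 3) L)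

theorem coe_cornerBlockGL (M : GL (Fin 2) L) :
    (cornerBlockGL M : Matrix (Fin 3) (Fin 3) L) =
      !![M 0 0, 0, M 0 1; 0, 1, 0; M 1 0, 0, M 1 1] := rfl

/-- The diagonal matrices of size two and determinant one. -/
def diagGL : Lˣ →* GL (Fin 2) L :=
  MonoidHom.toHomUnits
    { toFun := fun u => !![(u : L), 0; 0, ((u⁻¹ : Lˣ) : L)]
      map_one' := by ext i j; fin_cases i <;> fin_cases j <;> simp
      map_mul' := fun p q => by
        ext i j
        fin_cases i <;> fin_cases j <;> simp [Matrix.mul_apply, mul_comm] }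

theorem coe_diagGL (u : Lˣ) :
    (diagGL u : Matrix (Fin 2) (Fin 2) L) = !![(u : L), 0; 0, ((u⁻¹ : Lˣ) : L)] := rfl

/-- The invertible scalar matrices of size two. -/
def scalarGL : Lˣ →* GL (Fin 2) L :=
  Units.map (Matrix.scalar (Fin 2) : L →+* Matrix (Fin 2) (Fin 2) L).toMonoidHom

theorem coe_scalarGL (u : Lˣ) :
    (scalarGL u : Matrix (Fin 2) (Fin 2) L) = !![(u : L), 0; 0, (u : L)] := by
  ext i j
  fin_cases i <;> fin_cases j <;> simp [scalarGL]

/-- The diagonal matrix with entries `φ, φ ^ 2, φ ^ 3`. -/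
def powersGL : Lˣ →* GL (Fin 3) L :=
  MonoidHom.toHomUnits
    { toFun := fun u => matD (u : L)
      map_one' := by ext i j; fin_cases i <;> fin_cases j <;> simp [matD]
      map_mul' := fun p q => by
        ext i j
        fin_cases i <;> fin_cases j <;>
          simp [matD, Matrix.mul_apply, Fin.sum_univ_succ, mul_pow] }

theorem coe_powersGL (u : Lˣ) : (powersGL u : Matrix (Fin 3) (Fin 3) L) = matD (u : L) := rfl

theorem upperBlockGL_injective : Function.Injective (upperBlockGL (L := L)) := by
  rintro ⟨M, u⟩ ⟨N, v⟩ h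
  have h' := (Matrix.GeneralLinearGroup.ext_iff _ _).1 h
  simp only [coe_upperBlockGL] at h'
  have e00 := h' 0 0
  have e01 := h' 0 1
  have e10 := h' 1 0
  have e11 := h' 1 1
  have e22 := h' 2 2
  simp at e00 e01 e10 e11 e22
  refine Prod.ext (Matrix.GeneralLinearGroup.ext fun i j => ?_) (Units.ext e22)
  fin_cases i <;> fin_cases j <;> assumption

theorem map_upperBlockGL (σ : K →+* L) (M : GL (Fin 2) K) (u : Kˣ) :
    Matrix.GeneralLinearGroup.map σ (upperBlockGL (M, u)) =
      upperBlockGL (Matrix.GeneralLinearGroup.map σ M, Units.map σ.toMonoidHom u) := by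
  ext i j
  rw [Matrix.GeneralLinearGroup.map_apply, coe_upperBlockGL, coe_upperBlockGL]
  fin_cases i <;> fin_cases j <;> simp

theorem map_cornerBlockGL (σ : K →+* L) (M : GL (Fin 2) K) :
    Matrix.GeneralLinearGroup.map σ (cornerBlockGL M) =
      cornerBlockGL (Matrix.GeneralLinearGroup.map σ M) := by
  ext i j
  rw [Matrix.GeneralLinearGroup.map_apply, coe_cornerBlockGL, coe_cornerBlockGL]
  fin_cases i <;> fin_cases j <;> simp

theorem map_diagGL (σ : K →+* L) (u : Kˣ) :
    Matrix.GeneralLinearGroup.map σ (diagGL u) = diagGL (Units.map σ.toMonoidHom u) := by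
  ext i j
  rw [Matrix.GeneralLinearGroup.map_apply, coe_diagGL, coe_diagGL]
  fin_cases i <;> fin_cases j <;> simp

theorem map_scalarGL (σ : K →+* L) (u : Kˣ) :
    Matrix.GeneralLinearGroup.map σ (scalarGL u) = scalarGL (Units.map σ.toMonoidHom u) := by
  ext i j
  rw [Matrix.GeneralLinearGroup.map_apply, coe_scalarGL, coe_scalarGL]
  fin_cases i <;> fin_cases j <;> simp

theorem commute_scalarGL (u : Lˣ) (M : GL (Fin 2) L) : Commute M (scalarGL u) := by
  ext i j
  rw [Matrix.GeneralLinearGroup.coe_mul, Matrix.GeneralLinearGroup.coe_mul, coe_scalarGL]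
  fin_cases i <;> fin_cases j <;> simp [Matrix.mul_apply, mul_comm]

/-- On coordinates 0 and 2 the second matrix is the scalar `u`. -/
theorem commute_cornerBlockGL (M : GL (Fin 2) L) (u : Lˣ) :
    Commute (cornerBlockGL M) (upperBlockGL (diagGL u, u)) := by
  ext i j
  rw [Matrix.GeneralLinearGroup.coe_mul, Matrix.GeneralLinearGroup.coe_mul, coe_cornerBlockGL,
    coe_upperBlockGL, coe_diagGL]
  fin_cases i <;> fin_cases j <;> simp [Matrix.mul_apply, Fin.sum_univ_succ, mul_comm]

theorem commute_powersGL (φ u : Lˣ) :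
    Commute (powersGL φ) (upperBlockGL (diagGL u, u)) := by
  ext i j
  rw [Matrix.GeneralLinearGroup.coe_mul, Matrix.GeneralLinearGroup.coe_mul, coe_powersGL,
    coe_upperBlockGL, coe_diagGL]
  fin_cases i <;> fin_cases j <;> simp [matD, Matrix.mul_apply, Fin.sum_univ_succ, mul_comm]

/-- The off-diagonal entries of f f⁻¹ = 1 combine the two terms of each entry into one multiple of
M₀₀ − u, so their vanishing becomes a condition on the block matrix alone. -/
theorem conj_cornerBlockGL_apply (f M : GL (Fin 2) L) (u : Lˣ) :
    (cornerBlockGL f * upperBlockGL (M, u) * (cornerBlockGL f)⁻¹ : GL (Fin 3) L) 0 2 =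
      f 0 0 * (f⁻¹ : GL (Fin 2) L) 0 1 * (M 0 0 - u) ∧
    (cornerBlockGL f * upperBlockGL (M, u) * (cornerBlockGL f)⁻¹ : GL (Fin 3) L) 2 0 =
      f 1 1 * (f⁻¹ : GL (Fin 2) L) 1 0 * (u - M 0 0) := by
  have h : (f : Matrix (Fin 2) (Fin 2) L) * ((f⁻¹ : GL (Fin 2) L) : Matrix (Fin 2) (Fin 2) L) = 1 := by
    rw [← Matrix.GeneralLinearGroup.coe_mul, mul_inv_cancel, Matrix.GeneralLinearGroup.coe_one]
  have h01 := congrFun (congrFun h 0) 1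
  have h10 := congrFun (congrFun h 1) 0
  rw [Matrix.mul_apply, Fin.sum_univ_two] at h01 h10
  simp only [Matrix.one_apply, Fin.isValue, zero_ne_one, one_ne_zero, if_false] at h01 h10
  rw [← map_inv, Matrix.GeneralLinearGroup.coe_mul, Matrix.GeneralLinearGroup.coe_mul,
    coe_cornerBlockGL, coe_cornerBlockGL, coe_upperBlockGL]
  generalize ((f⁻¹ : GL (Fin 2) L) : Matrix (Fin 2) (Fin 2) L) = f' at h01 h10 ⊢
  constructor
  · simp [Matrix.mul_apply, Fin.sum_univ_succ]
    linear_combination (u : L) * h01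
  · simp [Matrix.mul_apply, Fin.sum_univ_succ]
    linear_combination (M 0 0 : L) * h10

open Polynomial in
-- Conjugation by D multiplies the (i, j) entry by φ^(i−j). The only pole in φ is at (0, 2) and the
-- only pole in φ⁻¹ at (2, 0), both of order at most two.
theorem exists_polynomial_conj_powersGL [Algebra K L] (φ : Lˣ) (M : GL (Fin 2) K) :
    (∃ B : Matrix (Fin 3) (Fin 3) K[X],
      (φ : L) ^ 2 • ((powersGL φ * cornerBlockGL (Matrix.GeneralLinearGroup.map (algebraMap K L) M) *
        (powersGL φ)⁻¹ : GL (Fin 3) L) : Matrix (Fin 3) (Fin 3) L) = (aeval (φ : L)).mapMatrix B ∧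
      (evalRingHom 0).mapMatrix B = Matrix.single 0 2 (M 0 1)) ∧
    (∃ B : Matrix (Fin 3) (Fin 3) K[X],
      ((φ⁻¹ : Lˣ) : L) ^ 2 • ((powersGL φ *
        cornerBlockGL (Matrix.GeneralLinearGroup.map (algebraMap K L) M) *
        (powersGL φ)⁻¹ : GL (Fin 3) L) : Matrix (Fin 3) (Fin 3) L) =
          (aeval ((φ⁻¹ : Lˣ) : L)).mapMatrix B ∧
      (evalRingHom 0).mapMatrix B = Matrix.single 2 0 (M 1 0)) := by
  have hφ : (φ : L) ≠ 0 := φ.ne_zero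
  rw [← map_inv, Matrix.GeneralLinearGroup.coe_mul, Matrix.GeneralLinearGroup.coe_mul,
    coe_cornerBlockGL, coe_powersGL, coe_powersGL]
  constructor
  · refine ⟨!![X ^ 2 * C (M 0 0), 0, C (M 0 1); 0, X ^ 2, 0; X ^ 4 * C (M 1 0), 0, X ^ 2 * C (M 1 1)],
      ?_, ?_⟩
    · ext i j
      fin_cases i <;> fin_cases j <;> simp [matD] <;> field_simp
    · ext i j
      fin_cases i <;> fin_cases j <;> simp
  · refine ⟨!![X ^ 2 * C (M 0 0), 0, X ^ 4 * C (M 0 1); 0, X ^ 2, 0; C (M 1 0), 0, X ^ 2 * C (M 1 1)],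
      ?_, ?_⟩
    · ext i j
      fin_cases i <;> fin_cases j <;> simp [matD] <;> field_simp
    · ext i j
      fin_cases i <;> fin_cases j <;> simp

end BlockMatrices

/-! ### Words in G, Q, P -/

/-- In a group where `Q` commutes with `G` and `P`, the elements of `⟨G, Q, P⟩` are products of a
power of `Q` and a word in `G` and `P`. -/
theorem exists_zpow_mul_lift_of_mem_closure {R : Type*} [Group R] {G Q P : R} (hGQ : Commute G Q)
    (hQP : Commute Q P) {x : R} (hx : x ∈ Subgroup.closure {G, Q, P}) :
    ∃ (k : ℤ) (w : FreeGroup (Fin 2)), x = Q ^ k * FreeGroup.lift ![G, P] w := by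
  have hG : ∀ w, G * FreeGroup.lift ![G, P] w = FreeGroup.lift ![G, P] (FreeGroup.of 0 * w) := by
    intro w; simp
  have hP : ∀ w, P * FreeGroup.lift ![G, P] w = FreeGroup.lift ![G, P] (FreeGroup.of 1 * w) := by
    intro w; simp
  have hG' : ∀ w, G⁻¹ * FreeGroup.lift ![G, P] w =
      FreeGroup.lift ![G, P] ((FreeGroup.of 0)⁻¹ * w) := by
    intro w; simp
  have hP' : ∀ w, P⁻¹ * FreeGroup.lift ![G, P] w =
      FreeGroup.lift ![G, P] ((FreeGroup.of 1)⁻¹ * w) := by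
    intro w; simp
  induction hx using Subgroup.closure_induction_left with
  | one => exact ⟨0, 1, by simp⟩
  | mul_left s hs y _ ih =>
    obtain ⟨k, w, rfl⟩ := ih
    rcases hs with rfl | rfl | rfl
    · exact ⟨k, _, by rw [← hG, ← mul_assoc, (hGQ.zpow_right k).eq, mul_assoc]⟩
    · exact ⟨1 + k, w, by rw [zpow_add, zpow_one, mul_assoc]⟩
    · exact ⟨k, _, by rw [← hP, ← mul_assoc, (hQP.symm.zpow_right k).eq, mul_assoc]⟩
  | inv_mul_cancel s hs y _ ih =>
    obtain ⟨k, w, rfl⟩ := ih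
    rcases hs with rfl | rfl | rfl
    · exact ⟨k, _, by rw [← hG', ← mul_assoc, (hGQ.inv_left.zpow_right k).eq, mul_assoc]⟩
    · exact ⟨-1 + k, w, by rw [zpow_add, zpow_neg_one, mul_assoc]⟩
    · exact ⟨k, _, by rw [← hP', ← mul_assoc, (hQP.symm.inv_left.zpow_right k).eq, mul_assoc]⟩

/-- The total exponent of the second generator. -/
def secondExponent : FreeGroup (Fin 2) →* Multiplicative ℤ :=
  FreeGroup.lift ![1, Multiplicative.ofAdd 1]

theorem secondExponent_of_one_zpow (n : ℤ) :
    secondExponent (FreeGroup.of 1 ^ n) = Multiplicative.ofAdd n := by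
  rw [map_zpow, secondExponent, FreeGroup.lift_apply_of]
  simp [← ofAdd_zsmul]

section

variable {L : Type*} [Field L]

/-- The last diagonal entry sees only the exponent sum of P, since G contributes 1 there. -/
theorem lift_upperBlockGL (g : GL (Fin 2) L) (u : Lˣ) (w : FreeGroup (Fin 2)) :
    FreeGroup.lift ![upperBlockGL (g, 1), upperBlockGL (diagGL u, u)] w =
      upperBlockGL (FreeGroup.lift ![g, diagGL u] w, u ^ (secondExponent w).toAdd) := by
  have : FreeGroup.lift ![upperBlockGL (g, 1), upperBlockGL (diagGL u, u)] =
      upperBlockGL.comp ((FreeGroup.lift ![g, diagGL u]).prod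
        ((zpowersHom Lˣ u).comp secondExponent)) := by
    apply FreeGroup.ext_hom
    intro i
    fin_cases i <;> simp [secondExponent]
  rw [this]
  simp [zpowersHom_apply]

/-- The images of the words in `G`, `Q`, `P` outside of `⟨P⟩` have different first and last
diagonal entries. -/
theorem eq_of_one_zpow_of_diagonal_eq {g : GL (Fin 2) L} {u : Lˣ}
    (hinj : Function.Injective (FreeGroup.lift ![g, diagGL u]))
    (hone : ∀ M ∈ Subgroup.closure {g, diagGL u}, M 0 0 = 1 → M = 1)
    (k : ℤ) (w : FreeGroup (Fin 2))
    (h : (scalarGL (u ^ k) * FreeGroup.lift ![g, diagGL u] w : GL (Fin 2) L) 0 0 =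
      ((u⁻¹ ^ k * u ^ (secondExponent w).toAdd : Lˣ) : L)) :
    k = 0 ∧ ∃ n : ℤ, w = FreeGroup.of 1 ^ n := by
  set e := (secondExponent w).toAdd with he
  have hmem : ∀ v, FreeGroup.lift ![g, diagGL u] v ∈ Subgroup.closure {g, diagGL u} := by
    intro v
    have : Set.range ![g, diagGL u] = {g, diagGL u} := by
      simp [Matrix.range_cons, Set.pair_comm]
    rw [← this, ← FreeGroup.range_lift_eq_closure]
    exact ⟨v, rfl⟩
  have hpow : ∀ j : ℤ, FreeGroup.lift ![g, diagGL u] (FreeGroup.of 1 ^ j) = diagGL (u ^ j) := by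
    intro j
    simp
  -- By `h` the top left entry of `w` is u^(e − 2k); this power of the second generator normalizes
  -- it to 1, where `hone` applies.
  have h1 : FreeGroup.of 1 ^ (2 * k - e) * w = 1 := by
    apply hinj
    rw [map_one]
    apply hone _ (hmem _)
    rw [_root_.map_mul, hpow, Matrix.GeneralLinearGroup.coe_mul, coe_diagGL]
    rw [Matrix.GeneralLinearGroup.coe_mul, coe_scalarGL] at h
    simp only [Matrix.mul_apply, Fin.sum_univ_two, Matrix.of_apply, Matrix.cons_val', Matrix.cons_val_zero,
      Matrix.cons_val_one, Matrix.cons_val_fin_one, zero_mul, add_zero] at h ⊢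
    have : (u ^ (2 * k - e) : Lˣ) = (u⁻¹ ^ k * u ^ e)⁻¹ * u ^ k := by
      rw [inv_zpow', ← zpow_add, ← zpow_neg, ← zpow_add]
      congr 1
      ring
    rw [this, Units.val_mul, mul_assoc, h, Units.inv_mul]
  have hw : w = FreeGroup.of 1 ^ (e - 2 * k) := by
    rw [eq_inv_of_mul_eq_one_right h1, ← zpow_neg, neg_sub]
  refine ⟨?_, _, hw⟩
  -- Comparing exponent sums gives e = e − 2k, hence k = 0.
  have := secondExponent_of_one_zpow (e - 2 * k)
  rw [← hw] at this
  have := congrArg Multiplicative.toAdd this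
  rw [toAdd_ofAdd, ← he] at this
  omega

end

/-! ### The group of the path and faithfulness -/

theorem commute_gen {V : Type*} {Γ : SimpleGraph V} {u v : V} (h : Γ.Adj u v) :
    Commute (RAAG.gen Γ u) (RAAG.gen Γ v) := by
  have : (PresentedGroup.mk {r : FreeGroup V | ∃ u v : V, Γ.Adj u v ∧
      r = FreeGroup.of u * FreeGroup.of v * (FreeGroup.of u)⁻¹ * (FreeGroup.of v)⁻¹})
      (FreeGroup.of u * FreeGroup.of v * (FreeGroup.of u)⁻¹ * (FreeGroup.of v)⁻¹) = 1 :=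
    PresentedGroup.one_of_mem ⟨u, v, h, rfl⟩
  simp only [_root_.map_mul, map_inv] at this
  rw [mul_inv_eq_one, mul_inv_eq_iff_eq_mul] at this
  exact this

/-- A map of the vertices to a group that sends adjacent vertices to commuting elements extends
to the right angled Artin group. -/
theorem exists_raag_hom {V H : Type*} [Group H] {Γ : SimpleGraph V} (t : V → H)
    (ht : ∀ u v, Γ.Adj u v → Commute (t u) (t v)) :
    ∃ ρ : RAAG Γ →* H, ∀ v, ρ (RAAG.gen Γ v) = t v := by
  refine ⟨PresentedGroup.toGroup (f := t) ?_, fun v => PresentedGroup.toGroup.of _⟩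
  rintro r ⟨u, v, h, rfl⟩
  simp only [_root_.map_mul, map_inv, FreeGroup.lift_apply_of]
  rw [(ht u v h).eq, mul_inv_cancel_right, mul_inv_cancel]

theorem exists_path_raag_hom {H : Type*} [Group H] {G Q P F : H} (hGQ : Commute G Q)
    (hQP : Commute Q P) (hPF : Commute P F) :
    ∃ ρ : RAAG (SimpleGraph.pathGraph 4) →* H, ρ (RAAG.gen _ 0) = G ∧ ρ (RAAG.gen _ 1) = Q ∧
      ρ (RAAG.gen _ 2) = P ∧ ρ (RAAG.gen _ 3) = F := by
  obtain ⟨ρ, hρ⟩ := exists_raag_hom (Γ := SimpleGraph.pathGraph 4) ![G, Q, P, F] (by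
    intro u v h
    rw [SimpleGraph.pathGraph_adj] at h
    fin_cases u <;> fin_cases v <;> simp at h <;>
      first | exact hGQ | exact hGQ.symm | exact hQP | exact hQP.symm | exact hPF | exact hPF.symm)
  exact ⟨ρ, hρ 0, hρ 1, hρ 2, hρ 3⟩

theorem path_raag_mem_or_eq_mul_alternatingProduct (x : RAAG (SimpleGraph.pathGraph 4)) :
    x ∈ Subgroup.closure {RAAG.gen (SimpleGraph.pathGraph 4) 0, RAAG.gen _ 1, RAAG.gen _ 2} ∨
    ∃ a ∈ Subgroup.closure {RAAG.gen (SimpleGraph.pathGraph 4) 0, RAAG.gen _ 1, RAAG.gen _ 2},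
      ∃ y, AlternatingProduct
        (Subgroup.closure {RAAG.gen (SimpleGraph.pathGraph 4) 0, RAAG.gen _ 1, RAAG.gen _ 2})
        (Subgroup.zpowers (RAAG.gen _ 2)) (RAAG.gen _ 3) y ∧ x = a * y := by
  refine mem_or_eq_mul_alternatingProduct ?_ Subgroup.subset_closure ?_ x
  · rintro c ⟨n, rfl⟩
    exact (commute_gen (by simp [SimpleGraph.pathGraph_adj])).zpow_right n
  · rw [eq_top_iff, ← PresentedGroup.closure_range_of, Subgroup.closure_le]
    rintro _ ⟨i, rfl⟩
    apply Subgroup.subset_closure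
    change RAAG.gen _ i ∈ _
    fin_cases i <;> simp

/-- The representation of the group of the path on four vertices is faithful. -/
theorem injective_path_raag_hom {K L : Type*} [Field K] [Field L] [Algebra K L]
    (g f : GL (Fin 2) K) (u : Kˣ) (φ : Lˣ) (hφ : Transcendental K (φ : L))
    (g' f' : GL (Fin 2) L) (u' : Lˣ)
    (hg : Matrix.GeneralLinearGroup.map (algebraMap K L) g = g')
    (hf : Matrix.GeneralLinearGroup.map (algebraMap K L) f = f')
    (hu : Units.map (algebraMap K L).toMonoidHom u = u')
    (h1 : ∀ n : ℤ, n ≠ 0 → (f' ^ n) 0 1 ≠ 0 ∧ (f' ^ n) 1 0 ≠ 0)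
    (hfree : IsNonabelianFree (Subgroup.closure {g', diagGL u'}))
    (hone : ∀ M ∈ Subgroup.closure {g', diagGL u'}, M 0 0 = 1 → M = 1)
    (ρ : RAAG (SimpleGraph.pathGraph 4) →* GL (Fin 3) L)
    (hρ0 : ρ (RAAG.gen _ 0) = cornerBlockGL f' * upperBlockGL (g', 1) * (cornerBlockGL f')⁻¹)
    (hρ1 : ρ (RAAG.gen _ 1) =
      cornerBlockGL f' * upperBlockGL (scalarGL u', u'⁻¹) * (cornerBlockGL f')⁻¹)
    (hρ2 : ρ (RAAG.gen _ 2) = upperBlockGL (diagGL u', u'))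
    (hρ3 : ρ (RAAG.gen _ 3) = powersGL φ * cornerBlockGL f' * (powersGL φ)⁻¹) :
    Function.Injective ρ := by
  have hinj := FreeGroup.lift_injective_of_isNonabelianFree g' (diagGL u') hfree
  set A := Subgroup.closure {RAAG.gen (SimpleGraph.pathGraph 4) 0, RAAG.gen _ 1, RAAG.gen _ 2}
    with hAdef
  -- P is fixed under conjugation by F₀, so one conjugation puts all of `A` into block form.
  have hρ2' : ρ (RAAG.gen _ 2) =
      cornerBlockGL f' * upperBlockGL (diagGL u', u') * (cornerBlockGL f')⁻¹ := by
    rw [hρ2, (commute_cornerBlockGL f' u').eq, mul_inv_cancel_right]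
  have hshape : ∀ x ∈ A, ∃ (k : ℤ) (w : FreeGroup (Fin 2)),
      x = RAAG.gen _ 1 ^ k * FreeGroup.lift ![RAAG.gen _ 0, RAAG.gen _ 2] w ∧
      ρ x = cornerBlockGL f' * upperBlockGL (scalarGL (u' ^ k) * FreeGroup.lift ![g', diagGL u'] w,
        u'⁻¹ ^ k * u' ^ (secondExponent w).toAdd) * (cornerBlockGL f')⁻¹ := by
    intro x hx
    obtain ⟨k, w, rfl⟩ := exists_zpow_mul_lift_of_mem_closure
      (commute_gen (by simp [SimpleGraph.pathGraph_adj]))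
      (commute_gen (by simp [SimpleGraph.pathGraph_adj])) hx
    refine ⟨k, w, rfl, ?_⟩
    have hw : ρ.comp (FreeGroup.lift ![RAAG.gen _ 0, RAAG.gen _ 2]) =
        (MulAut.conj (cornerBlockGL f')).toMonoidHom.comp
          (FreeGroup.lift ![upperBlockGL (g', 1), upperBlockGL (diagGL u', u')]) := by
      apply FreeGroup.ext_hom
      intro i
      fin_cases i
      · simpa using hρ0
      · simpa using hρ2'
    have hw' := DFunLike.congr_fun hw w
    simp only [MonoidHom.comp_apply, lift_upperBlockGL, MulEquiv.toMonoidHom_eq_coe,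
      MonoidHom.coe_coe, MulAut.conj_apply] at hw'
    rw [_root_.map_mul, map_zpow, hρ1, hw', conj_zpow, ← map_zpow, Prod.pow_mk, ← map_zpow scalarGL,
      ← Prod.mk_mul_mk, _root_.map_mul]
    group
  have hP : ∀ x ∈ A, ∀ (M : GL (Fin 2) L) (v : Lˣ),
      ρ x = cornerBlockGL f' * upperBlockGL (M, v) * (cornerBlockGL f')⁻¹ → M 0 0 = v →
      x ∈ Subgroup.zpowers (RAAG.gen _ 2) := by
    intro x hx M v hM hv
    obtain ⟨k, w, hkw, hρx⟩ := hshape x hx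
    rw [hρx, mul_left_inj, mul_right_inj] at hM
    obtain ⟨rfl, rfl⟩ := Prod.ext_iff.1 (upperBlockGL_injective hM)
    obtain ⟨rfl, n, rfl⟩ := eq_of_one_zpow_of_diagonal_eq hinj hone k w hv
    refine ⟨n, ?_⟩
    simp [hkw]
  have hA : ∀ a ∈ A, ρ a ∈ (Matrix.GeneralLinearGroup.map (n := Fin 3) (algebraMap K L)).range := by
    suffices A ≤ (Matrix.GeneralLinearGroup.map (n := Fin 3) (algebraMap K L)).range.comap ρ from
      fun a ha => this ha
    rw [hAdef, Subgroup.closure_le]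
    have hcorner : cornerBlockGL f' ∈
        (Matrix.GeneralLinearGroup.map (n := Fin 3) (algebraMap K L)).range :=
      ⟨cornerBlockGL f, by rw [map_cornerBlockGL, hf]⟩
    rintro _ (rfl | rfl | rfl)
    · rw [SetLike.mem_coe, Subgroup.mem_comap, hρ0]
      exact mul_mem (mul_mem hcorner ⟨upperBlockGL (g, 1), by rw [map_upperBlockGL, hg, map_one]⟩)
        (inv_mem hcorner)
    · rw [SetLike.mem_coe, Subgroup.mem_comap, hρ1]
      exact mul_mem (mul_mem hcorner ⟨upperBlockGL (scalarGL u, u⁻¹), by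
        rw [map_upperBlockGL, map_scalarGL, map_inv, hu]⟩) (inv_mem hcorner)
    · rw [SetLike.mem_coe, Subgroup.mem_comap, hρ2]
      exact ⟨upperBlockGL (diagGL u, u), by rw [map_upperBlockGL, map_diagGL, hu]⟩
  -- The identity has equal diagonal entries, so a kernel element is a power of P; freeness gives
  -- the image of P infinite order.
  have hker : ∀ a ∈ A, ρ a = 1 → a = 1 := by
    intro a ha h
    obtain ⟨n, rfl⟩ := hP a ha 1 1 (by
      rw [h, show ((1 : GL (Fin 2) L), (1 : Lˣ)) = 1 from rfl, map_one, mul_one, mul_inv_cancel])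
      (by simp)
    simp only [map_zpow, hρ2] at h
    rw [← map_zpow, Prod.pow_mk, ← map_one upperBlockGL] at h
    have hd := (Prod.ext_iff.1 (upperBlockGL_injective h)).1
    have : (FreeGroup.of 1 : FreeGroup (Fin 2)) ^ n = 1 := by
      apply hinj
      rw [map_zpow, FreeGroup.lift_apply_of, map_one]
      exact hd
    have hn := secondExponent_of_one_zpow n
    rw [this, map_one] at hn
    have : n = 0 := (congrArg Multiplicative.toAdd hn).symm
    simp [this]
  have hpowf : ∀ m : ℤ, ρ (RAAG.gen _ 3 ^ m) = powersGL φ * cornerBlockGL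
      (Matrix.GeneralLinearGroup.map (algebraMap K L) (f ^ m)) * (powersGL φ)⁻¹ := by
    intro m
    rw [map_zpow, hρ3, conj_zpow, map_zpow, map_zpow, hf]
  have hentry : ∀ m : ℤ, m ≠ 0 → (f ^ m) 0 1 ≠ 0 ∧ (f ^ m) 1 0 ≠ 0 := by
    intro m hm
    have := h1 m hm
    rw [← hf, ← map_zpow, Matrix.GeneralLinearGroup.map_apply,
      Matrix.GeneralLinearGroup.map_apply] at this
    exact ⟨fun h => this.1 (by rw [h, map_zero]), fun h => this.2 (by rw [h, map_zero])⟩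
  have hinv := h1 (-1) (by norm_num)
  rw [zpow_neg_one] at hinv
  -- With zero diagonal, the square of `f'` would be diagonal, against `h1` at n = 2.
  have hdiag : f' 0 0 ≠ 0 ∨ f' 1 1 ≠ 0 := by
    by_contra! h
    apply (h1 2 two_ne_zero).1
    rw [zpow_ofNat, pow_two, Matrix.GeneralLinearGroup.coe_mul, Matrix.mul_apply, Fin.sum_univ_two,
      h.1, h.2, zero_mul, mul_zero, add_zero]
  -- The nonzero diagonal entry decides which corner of `A` is controlled: f₀₀ the (0, 2) entry,
  -- which pairs with E₂₀ and ψ = φ⁻¹; f₁₁ the (2, 0) entry, which pairs with E₀₂ and ψ = φ.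
  rcases hdiag with h0 | h0
  · have hφ' : Transcendental K ((φ⁻¹ : Lˣ) : L) := by
      intro h
      apply hφ
      have := h.inv
      rwa [← Units.val_inv_eq_inv_val, inv_inv] at this
    refine injective_of_leading_term hφ' path_raag_mem_or_eq_mul_alternatingProduct ρ 2 0 hA ?_ ?_
      hker
    · intro a ha haC h
      obtain ⟨k, w, -, hρa⟩ := hshape a ha
      rw [hρa, (conj_cornerBlockGL_apply _ _ _).1] at h
      exact haC (hP a ha _ _ hρa (sub_eq_zero.1
        ((mul_eq_zero.1 h).resolve_left (mul_ne_zero h0 hinv.1))))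
    · intro m hm
      obtain ⟨B, hB, hB0⟩ := (exists_polynomial_conj_powersGL φ (f ^ m)).2
      exact ⟨B, _, (hentry m hm).2, by rw [hpowf, hB], hB0⟩
  · refine injective_of_leading_term hφ path_raag_mem_or_eq_mul_alternatingProduct ρ 0 2 hA ?_ ?_
      hker
    · intro a ha haC h
      obtain ⟨k, w, -, hρa⟩ := hshape a ha
      rw [hρa, (conj_cornerBlockGL_apply _ _ _).2] at h
      exact haC (hP a ha _ _ hρa (sub_eq_zero.1
        ((mul_eq_zero.1 h).resolve_left (mul_ne_zero h0 hinv.2))).symm)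
    · intro m hm
      obtain ⟨B, hB, hB0⟩ := (exists_polynomial_conj_powersGL φ (f ^ m)).1
      exact ⟨B, _, (hentry m hm).1, by rw [hpowf, hB], hB0⟩

/-! ### The given matrices and the main theorem -/

theorem gl2Diag_eq_diagGL {F : Type*} [Field F] (lam : F) (h : lam ≠ 0) :
    gl2Diag lam h = diagGL (Units.mk0 lam h) := by
  ext i j
  fin_cases i <;> fin_cases j <;> simp [gl2Diag, gl2, coe_diagGL, Matrix.GeneralLinearGroup.mkOfDetNeZero]

theorem coe_gl2 {F : Type*} [Field F] (a b c d : F) (h : a * d - b * c ≠ 0) :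
    (gl2 a b c d h : Matrix (Fin 2) (Fin 2) F) = !![a, b; c, d] := rfl

theorem exists_map_eq_gl2 {k F : Type*} [Field k] [Field F] [Algebra k F]
    (K : IntermediateField k F) {a b c d : F} (h : a * d - b * c ≠ 0) (ha : a ∈ K) (hb : b ∈ K)
    (hc : c ∈ K) (hd : d ∈ K) :
    ∃ g : GL (Fin 2) K, Matrix.GeneralLinearGroup.map (algebraMap K F) g = gl2 a b c d h := by
  refine ⟨gl2 ⟨a, ha⟩ ⟨b, hb⟩ ⟨c, hc⟩ ⟨d, hd⟩ fun h0 => h (congrArg (algebraMap K F) h0), ?_⟩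
  ext i j
  rw [Matrix.GeneralLinearGroup.map_apply, coe_gl2, coe_gl2]
  fin_cases i <;> fin_cases j <;> rfl

/-- The vertices `0, 1, 2, 3` of the path carry the labels `G, Q, P, F`. The determinants of the
matrices that are inverted are nonzero: `φ ≠ 0` because `φ` is transcendental. -/
theorem mainTheorem7 {F : Type*} [Field F] (a b c d α β γ δ lam φ : F)
    (hG : a * d - b * c ≠ 0) (hF : α * δ - β * γ ≠ 0) (hlam : lam ≠ 0)
    (h1 : ∀ n : ℤ, n ≠ 0 →
      (gl2 α β γ δ hF ^ n : GL (Fin 2) F) 0 1 ≠ 0 ∧ (gl2 α β γ δ hF ^ n : GL (Fin 2) F) 1 0 ≠ 0)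
    (h2free : IsNonabelianFree (Subgroup.closure {gl2 a b c d hG, gl2Diag lam hlam}))
    (h2one : ∀ M ∈ Subgroup.closure {gl2 a b c d hG, gl2Diag lam hlam}, M 0 0 = 1 → M = 1)
    (hφ : Transcendental
      (IntermediateField.adjoin (⊥ : Subfield F) ({a, b, c, d, α, β, γ, δ, lam} : Set F)) φ) :
    matF₀ α β γ δ * matP₀ lam * (matF₀ α β γ δ)⁻¹ = matP₀ lam ∧
    matD φ * matP₀ lam * (matD φ)⁻¹ = matP₀ lam ∧
    ∃ ρ : RAAG (SimpleGraph.pathGraph 4) →* GL (Fin 3) F,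
      (ρ (RAAG.gen _ 0) : Matrix (Fin 3) (Fin 3) F) =
        matF₀ α β γ δ * matG₀ a b c d * (matF₀ α β γ δ)⁻¹ ∧
      (ρ (RAAG.gen _ 1) : Matrix (Fin 3) (Fin 3) F) =
        matF₀ α β γ δ * matQ₀ lam * (matF₀ α β γ δ)⁻¹ ∧
      (ρ (RAAG.gen _ 2) : Matrix (Fin 3) (Fin 3) F) =
        matD φ * matP₀ lam * (matD φ)⁻¹ ∧
      (ρ (RAAG.gen _ 3) : Matrix (Fin 3) (Fin 3) F) =
        matD φ * matF₀ α β γ δ * (matD φ)⁻¹ ∧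
      Function.Injective ρ := by
  have hφ0 : φ ≠ 0 := by
    rintro rfl
    exact hφ isAlgebraic_zero
  set S : Set F := {a, b, c, d, α, β, γ, δ, lam} with hS
  set K := IntermediateField.adjoin (⊥ : Subfield F) S with hK
  have hmem : ∀ x ∈ S, x ∈ K := fun x hx => IntermediateField.subset_adjoin _ _ hx
  obtain ⟨g, hg⟩ := exists_map_eq_gl2 K hG (hmem a (by simp [hS])) (hmem b (by simp [hS]))
    (hmem c (by simp [hS])) (hmem d (by simp [hS]))
  obtain ⟨f, hf⟩ := exists_map_eq_gl2 K hF (hmem α (by simp [hS])) (hmem β (by simp [hS]))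
    (hmem γ (by simp [hS])) (hmem δ (by simp [hS]))
  let u : Kˣ := Units.mk0 ⟨lam, hmem lam (by simp [hS])⟩
    fun h => hlam (congrArg (algebraMap K F) h)
  have hu : Units.map (algebraMap K F).toMonoidHom u = Units.mk0 lam hlam := Units.ext rfl
  rw [gl2Diag_eq_diagGL] at h2free h2one
  set g' := gl2 a b c d hG with hg'
  set f' := gl2 α β γ δ hF with hf'
  set v := Units.mk0 lam hlam with hv
  have eF : matF₀ α β γ δ = (cornerBlockGL f' : Matrix (Fin 3) (Fin 3) F) := by
    rw [coe_cornerBlockGL, hf', coe_gl2]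
    simp [matF₀]
  have eG : matG₀ a b c d = (upperBlockGL (g', 1) : Matrix (Fin 3) (Fin 3) F) := by
    rw [coe_upperBlockGL, hg', coe_gl2]
    simp [matG₀]
  have eQ : matQ₀ lam = (upperBlockGL (scalarGL v, v⁻¹) : Matrix (Fin 3) (Fin 3) F) := by
    rw [coe_upperBlockGL, coe_scalarGL]
    simp [matQ₀, hv]
  have eP : matP₀ lam = (upperBlockGL (diagGL v, v) : Matrix (Fin 3) (Fin 3) F) := by
    rw [coe_upperBlockGL, coe_diagGL]
    simp [matP₀, hv]
  have eD : matD φ = (powersGL (Units.mk0 φ hφ0) : Matrix (Fin 3) (Fin 3) F) := rfl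
  have cF := commute_cornerBlockGL f' v
  have cD := commute_powersGL (Units.mk0 φ hφ0) v
  rw [eF, eG, eQ, eP, eD]
  simp only [← Matrix.GeneralLinearGroup.coe_inv, ← Matrix.GeneralLinearGroup.coe_mul]
  have cGQ : Commute (upperBlockGL (g', 1)) (upperBlockGL (scalarGL v, v⁻¹)) :=
    Commute.map (Commute.prod (commute_scalarGL v g') (Commute.one_left _)) upperBlockGL
  have cQP : Commute (upperBlockGL (scalarGL v, v⁻¹)) (upperBlockGL (diagGL v, v)) :=
    Commute.map (Commute.prod (commute_scalarGL v _).symm (mul_comm _ _)) upperBlockGL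
  have hPF : cornerBlockGL f' * upperBlockGL (diagGL v, v) * (cornerBlockGL f')⁻¹ =
      upperBlockGL (diagGL v, v) := by
    rw [cF.eq, mul_inv_cancel_right]
  have hPD : powersGL (Units.mk0 φ hφ0) * upperBlockGL (diagGL v, v) *
      (powersGL (Units.mk0 φ hφ0))⁻¹ = upperBlockGL (diagGL v, v) := by
    rw [cD.eq, mul_inv_cancel_right]
  obtain ⟨ρ, h0, h1', h2, h3⟩ := exists_path_raag_hom
    (G := cornerBlockGL f' * upperBlockGL (g', 1) * (cornerBlockGL f')⁻¹)
    (Q := cornerBlockGL f' * upperBlockGL (scalarGL v, v⁻¹) * (cornerBlockGL f')⁻¹)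
    (P := upperBlockGL (diagGL v, v))
    (F := powersGL (Units.mk0 φ hφ0) * cornerBlockGL f' * (powersGL (Units.mk0 φ hφ0))⁻¹)
    -- P is its own conjugate by both F₀ and D: the relation with Q is a conjugate by F₀, the one
    -- with F a conjugate by D.
    ((Commute.conj_iff _).2 cGQ) (hPF ▸ (Commute.conj_iff _).2 cQP)
    (hPD ▸ (Commute.conj_iff _).2 cF.symm)
  refine ⟨congrArg Units.val hPF, congrArg Units.val hPD, ρ, congrArg Units.val h0,
    congrArg Units.val h1', congrArg Units.val (h2.trans hPD.symm), congrArg Units.val h3, ?_⟩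
  exact injective_path_raag_hom g f u (Units.mk0 φ hφ0) hφ g' f' v hg hf hu h1 h2free h2one ρ
    h0 h1' h2 h3
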